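/- **Setting.** Let $\mathcal Y$ be a finite set with $m$ elements, $p$ a probability distribution on $\mathcal Y$, and $H(p)=-\sum_{y\in\mathcal Y}p(y)\log_2 p(y)$ (with $0\log_2 0=0$). A code tree is a binary tree, each of whose inner nodes has a left and a right child, and whose leaves are in bijection with $\mathcal Y$. The code $c_{\mathcal T}(y)\in\{0,1\}^*$ is the path from the root of $\mathcal T$ to the leaf of $y$. To identify a sample with $\mathcal T$, one queries the entries of its code one after another (a query asks whether the sample belongs to the set of leaves below the right child of the current node); this takes $|c_{\mathcal T}(y)|$ queries if the sample equals $y$. A coding scheme $\mathcal A$ associates a code tree $\mathcal T_{\mathcal A}(q)$ to every probability distribution $q$ on $\mathcal Y$. For real $C$, it is called $C$-balanced if $$|c_{\mathcal T_{\mathcal A}(q)}(y)|\le C\left(\left\lfloor\log_2\tfrac1{q(y)}\right\rfloor+1\right)\qquad\text{for all } q \text{ and all } y \text{ with } q(y)>0.$$ (The factor in parentheses equals $\lceil\log_2(1/q(y))\rceil$ unless $q(y)$ is a power of $1/2$, where it is larger by one. In particular, every scheme that satisfies the bound $C\lceil\log_2(1/q(y))\rceil$ is $C$-balanced.) Let $Y_1,\dots,Y_n$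 ($n\ge1$) be i.i.d. with distribution $p$. They are fully identified one after another, $Y_{j+1}$ with a tree $\mathcal T_j$ that depends on $Y_1,\dots,Y_j$ only, and $T=\sum_{j=0}^{n-1}|c_{\mathcal T_j}(Y_{j+1})|$ is the total number of queries. **Theorem.** 1. (Adaptive coding.) Let $\mathcal A$ be a $C$-balanced coding scheme, let $\mathcal T_0$ be any code tree, and for $j\ge1$ let $\mathcal T_j=\mathcal T_{\mathcal A}(\hat p_j)$, where $\hat p_j(y)=\frac1j\#\{i\le j: Y_i=y\}$. Then $$nH(p)\le\mathbb E[T]\le Cn(H(p)+1)+28\,Cm\log_2 n+6\,Cm+m^2 .$$ 2. (Adaptive Huffman coding.) Suppose that for every $j\ge0$ the tree $\mathcal T_j$ is a Huffman tree for the counts $N_j(y)=\#\{i\le j: Y_i=y\}$, i.e. a possible result of Huffman's scheme: start from the leaves with values $N_j(y)$, and repeatedly merge two vertices of smallest value (ties broken arbitrarily) into a node whose value is the sum of theirs, until one tree is left. The tree may be recomputed or updated from $\mathcal T_{j-1}$ in any way, as a function of the samples identified so far. Then $$nH(p)\le\mathbb E[T]\le 2n(H(p)+1)+o(n)\qquad(n\to\infty),$$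 where the $o(n)$ term depends on $\mathcal Y$ and $n$ only. -/

import Mathlib

open MeasureTheory ProbabilityTheory Filter Asymptotics

/-- Binary trees whose leaves carry elements of `α`; an inner node has a left and a right child. -/
inductive BinTree (α : Type*) where
  | leaf (y : α) : BinTree α
  | node (l r : BinTree α) : BinTree α

namespace BinTree

variable {α : Type*}

/-- The leaf labels, from left to right. -/
def leaves : BinTree α → List α
  | leaf y => [y]
  | node l r => l.leaves ++ r.leaves

/-- The leaves of the tree are in bijection with the elements of `α`. -/
def IsCodeTree (t : BinTree α) : Prop :=
  t.leaves.Nodup ∧ ∀ y, y ∈ t.leaves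

/-- The code of `y`: the path from the root to the leaf of `y`, `true` for a step to the right and
`false` for a step to the left. Its entries are the answers to the successive queries
"does the sample belong to the set of leaves below the right child?", so its length is the number
of queries with which the tree identifies a sample equal to `y`. -/
def code [DecidableEq α] : BinTree α → α → List Bool
  | leaf _, _ => []
  | node l r, y => if y ∈ r.leaves then true :: r.code y else false :: l.code y

/-- The value of a vertex (the root of the tree `t`): the value of a leaf is that of its label,
the value of a node is the sum of the values of its children. -/
def value (v : α → ℕ) : BinTree α → ℕ
  | leaf y => v y
  | node l r => l.value v + r.value v

end BinTree

/-- One step of Huffman's scheme: two smallest elements `a`, `b` of the heap (ties are broken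
arbitrarily) are replaced by a node with left child `a` and right child `b`. -/
inductive HuffmanStep {α : Type*} (v : α → ℕ) :
    Multiset (BinTree α) → Multiset (BinTree α) → Prop where
  | merge (a b : BinTree α) (S : Multiset (BinTree α))
      (hab : a.value v ≤ b.value v) (hS : ∀ t ∈ S, b.value v ≤ t.value v) :
      HuffmanStep v (a ::ₘ b ::ₘ S) (BinTree.node a b ::ₘ S)

/-- `t` is a Huffman tree for the values `v`: a possible result of Huffman's scheme, which starts
from the heap of all leaves and merges until a single tree is left. -/
def IsHuffmanTree {α : Type*} [Fintype α] (v : α → ℕ) (t : BinTree α) : Prop :=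
  Relation.ReflTransGen (HuffmanStep v) ((Finset.univ : Finset α).val.map BinTree.leaf) {t}

/-- A coding scheme associates to every probability vector on `α` (an element of
`stdSimplex ℝ α`) a binary tree whose leaves are in bijection with `α`. The values outside the
simplex play no role. -/
structure CodingScheme (α : Type*) where
  tree : (α → ℝ) → BinTree α
  isCodeTree : ∀ p, (tree p).IsCodeTree

/-- `C`-balanced coding schemes: `|c(y)| ≤ C (⌊log₂ (1 / p y)⌋ + 1)` whenever `p y > 0`.
The factor is equal to `⌈log₂ (1 / p y)⌉` unless `p y` is a power of `1/2`, where it is larger by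
one: with the ceiling itself no tree with two or more leaves would do when `p y = 1`, so every
scheme that satisfies the bound with the ceiling also satisfies this one, but not conversely. -/
def CodingScheme.IsBalanced {α : Type*} [Fintype α] [DecidableEq α]
    (A : CodingScheme α) (C : ℝ) : Prop :=
  ∀ p ∈ stdSimplex ℝ α, ∀ y, 0 < p y →
    (((A.tree p).code y).length : ℝ) ≤ C * ((⌊Real.logb 2 (1 / p y)⌋ : ℝ) + 1)

/-- The empirical distribution of a non-empty list of samples. -/
noncomputable def empirical {α : Type*} [DecidableEq α] (h : List α) : α → ℝ :=
  fun y => (h.count y : ℝ) / (h.length : ℝ)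

/-- The trees used by adaptive coding: the initial tree `T₀` before the first sample, and then the
tree which the coding scheme associates to the empirical distribution of the samples
identified so far. -/
noncomputable def adaptiveTree {α : Type*} [DecidableEq α] (A : CodingScheme α)
    (T₀ : BinTree α) : List α → BinTree α
  | [] => T₀
  | y :: h => A.tree (empirical (y :: h))

/-- The total number of queries made to identify the samples `y 0, …, y (n - 1)` one after
another, when `τ h` is the tree in use once the list `h` of samples has been identified: the
`j`-th sample is identified with the tree built from the samples preceding it. -/
def totalQueries {α : Type*} [DecidableEq α] (τ : List α → BinTree α) {n : ℕ}
    (y : Fin n → α) : ℕ :=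
  ∑ j : Fin n, ((τ ((List.ofFn y).take j)).code (y j)).length

/-- The entropy of `p` in bits. -/
noncomputable def entropy₂ {α : Type*} [Fintype α] (p : α → ℝ) : ℝ :=
  -∑ y, p y * Real.logb 2 (p y)

/-- `Y 0, …, Y (n - 1)` are independent samples with distribution `p`. -/
structure IsIIDSample {α Ω : Type*} [MeasurableSpace α] [MeasurableSpace Ω]
    (μ : Measure Ω) {n : ℕ} (Y : Fin n → Ω → α) (p : α → ℝ) : Prop where
  measurable : ∀ j, Measurable (Y j)
  indep : iIndepFun Y μ
  law : ∀ j y, μ.real (Y j ⁻¹' {y}) = p y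

/-! ### Code lengths and Kraft's equality. -/

namespace BinTree

variable {α : Type*}

/-! Lower bound: the concatenated codes of a sequence form one adaptive code on words of length `n`,
which satisfies Kraft's equality; Gibbs' inequality bounds its mean length below by the entropy `n
H(p)` of the product law.

Upper bound: if a symbol seen before costs at most `a log₂ (j / N_j(y)) + b`, these logarithms add
up to `log₂` of `(n-1)! / ∏ (N(y)-1)!` (`logFactorialGap`). Up to factors contributing `m log₂ n`,
this is a multinomial coefficient, hence at most the inverse probability of the sequence, whose
logarithm has mean `n H(p)`. Each of the at most `m` first occurrences costs less than `m`, whence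
`m²`. Balanced schemes have `a = b = C`. Huffman trees have `a = 2`, `b = 1`, since values at least
double every two levels towards the root. -/

theorem code_length_lt_leaves_length [DecidableEq α] (t : BinTree α) (y : α) :
    (t.code y).length < t.leaves.length := by
  induction t with
  | leaf x => simp [code, leaves]
  | node l r hl hr =>
    have := List.length_pos_of_ne_nil (l := l.leaves) (by rintro h; simp [h] at hl)
    have := List.length_pos_of_ne_nil (l := r.leaves) (by rintro h; simp [h] at hr)
    simp only [code, leaves, List.length_append]
    split_ifs <;> simp only [List.length_cons] <;> omega

/-- Kraft's equality, as a sum over the list of leaves. -/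
theorem kraft_leaves [DecidableEq α] (t : BinTree α) (ht : t.leaves.Nodup) :
    (t.leaves.map fun y => ((1 / 2 : ℝ)) ^ (t.code y).length).sum = 1 := by
  induction t with
  | leaf x => simp [code, leaves]
  | node l r hl hr =>
    obtain ⟨h1, h2, h3⟩ := List.nodup_append.1 ht
    have el : (l.leaves.map fun y => ((1 / 2 : ℝ)) ^ ((node l r).code y).length)
        = l.leaves.map fun y => (1 / 2 : ℝ) * (1 / 2 : ℝ) ^ (l.code y).length := by
      refine List.map_congr_left fun y hy => ?_
      have : y ∉ r.leaves := fun h => h3 y hy y h rfl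
      simp [code, this, pow_succ']
    have er : (r.leaves.map fun y => ((1 / 2 : ℝ)) ^ ((node l r).code y).length)
        = r.leaves.map fun y => (1 / 2 : ℝ) * (1 / 2 : ℝ) ^ (r.code y).length := by
      refine List.map_congr_left fun y hy => ?_
      simp [code, hy, pow_succ']
    rw [leaves, List.map_append, List.sum_append, el, er, List.sum_map_mul_left,
      List.sum_map_mul_left, hl h1, hr h2]
    norm_num

theorem IsCodeTree.leaves_toFinset [Fintype α] [DecidableEq α] {t : BinTree α}
    (ht : t.IsCodeTree) : t.leaves.toFinset = Finset.univ :=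
  Finset.eq_univ_iff_forall.2 fun y => List.mem_toFinset.2 (ht.2 y)

theorem IsCodeTree.code_length_lt_card [Fintype α] [DecidableEq α] {t : BinTree α}
    (ht : t.IsCodeTree) (y : α) : (t.code y).length < Fintype.card α := by
  rw [← Finset.card_univ, ← ht.leaves_toFinset, List.toFinset_card_of_nodup ht.1]
  exact t.code_length_lt_leaves_length y

/-- Kraft's equality for a code tree. -/
theorem IsCodeTree.kraft [Fintype α] [DecidableEq α] {t : BinTree α} (ht : t.IsCodeTree) :
    ∑ y, ((1 / 2 : ℝ)) ^ (t.code y).length = 1 := by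
  rw [← ht.leaves_toFinset, List.sum_toFinset _ ht.1, t.kraft_leaves ht.1]

/-! ### Huffman trees: values grow geometrically towards the root. -/

theorem value_eq_sum_leaves (v : α → ℕ) (t : BinTree α) :
    t.value v = (t.leaves.map v).sum := by
  induction t with
  | leaf x => simp [value, leaves]
  | node l r hl hr => simp [value, leaves, hl, hr]

theorem IsCodeTree.value_eq [Fintype α] [DecidableEq α] {t : BinTree α}
    (ht : t.IsCodeTree) (v : α → ℕ) : t.value v = ∑ y, v y := by
  rw [value_eq_sum_leaves, ← ht.leaves_toFinset, List.sum_toFinset _ ht.1]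

/-- The larger value of the children of the root (`0` for a leaf). -/
def childMax (v : α → ℕ) : BinTree α → ℕ
  | leaf _ => 0
  | node l r => max (l.value v) (r.value v)

theorem childMax_le_value (v : α → ℕ) (t : BinTree α) : t.childMax v ≤ t.value v := by
  cases t <;> simp [childMax, value]

/-- In every subtree, no grandchild of the root is larger than its uncle. -/
def UncleDominates (v : α → ℕ) : BinTree α → Prop
  | leaf _ => True
  | node l r => l.UncleDominates v ∧ r.UncleDominates v ∧
      l.childMax v ≤ r.value v ∧ r.childMax v ≤ l.value v

/-- A vertex outweighs twice its grandchild on the path to `y`, as parent and uncle both weigh at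
least as much as that grandchild. The second claim carries the bound for the child of the root
through the induction. -/
theorem UncleDominates.mul_two_pow_le_aux [DecidableEq α] {v : α → ℕ} {t : BinTree α}
    (ht : t.UncleDominates v) {y : α} (hy : y ∈ t.leaves) :
    v y * 2 ^ ((t.code y).length / 2) ≤ t.value v ∧
      ∀ d, (t.code y).length = d + 1 → v y * 2 ^ (d / 2) ≤ t.childMax v := by
  induction t with
  | leaf x =>
    obtain rfl : y = x := by simpa [leaves] using hy
    simp [code, value]
  | node l r hl hr =>
    obtain ⟨gl, gr, hlr, hrl⟩ := ht
    have key : ∀ (s u : BinTree α) (d : ℕ), v y * 2 ^ (d / 2) ≤ s.value v →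
        (∀ e, d = e + 1 → v y * 2 ^ (e / 2) ≤ s.childMax v) → s.childMax v ≤ u.value v →
        v y * 2 ^ ((d + 1) / 2) ≤ u.value v + s.value v := by
      intro s u d h1 h2 h3
      rcases d with _ | e
      · simp at h1 ⊢
        omega
      · have h4 := h2 e rfl
        have h5 := s.childMax_le_value v
        rw [show (e + 1 + 1) / 2 = e / 2 + 1 by omega, pow_succ, ← mul_assoc]
        omega
    by_cases hyr : y ∈ r.leaves
    · obtain ⟨h1, h2⟩ := hr gr hyr
      simp only [code, hyr, if_true, List.length_cons, value, childMax]
      refine ⟨key r l _ h1 h2 hrl, ?_⟩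
      rintro d hd
      obtain rfl : (r.code y).length = d := by omega
      exact h1.trans (le_max_right _ _)
    · have hyl : y ∈ l.leaves := by simpa [leaves, hyr] using hy
      obtain ⟨h1, h2⟩ := hl gl hyl
      simp only [code, hyr, if_false, List.length_cons, value, childMax]
      refine ⟨(key l r _ h1 h2 hlr).trans (add_comm _ _).le, ?_⟩
      rintro d hd
      obtain rfl : (l.code y).length = d := by omega
      exact h1.trans (le_max_left _ _)

end BinTree

/-- The invariants of the heap in Huffman's scheme. -/
structure HuffmanHeap {α : Type*} [Fintype α] (v : α → ℕ) (S : Multiset (BinTree α)) : Prop where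
  leaves : (S.bind fun t => (t.leaves : Multiset α)) = (Finset.univ : Finset α).val
  uncle : ∀ t ∈ S, t.UncleDominates v
  child : ∀ t ∈ S, ∀ u ∈ S, t.childMax v ≤ u.value v

/-- The invariant `child` bounds the children of `a` by `b` and vice versa, which is uncle
domination at the new node. It persists because `a` and `b` are minimal in the heap and the new root
is heavier than `a`. -/
theorem HuffmanHeap.step {α : Type*} [Fintype α] {v : α → ℕ} {S S' : Multiset (BinTree α)}
    (hS : HuffmanHeap v S) (h : HuffmanStep v S S') : HuffmanHeap v S' := by
  obtain ⟨a, b, S, hab, hbS⟩ := h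
  obtain ⟨h1, h2, h3⟩ := hS
  simp only [Multiset.mem_cons, forall_eq_or_imp] at h2 h3
  obtain ⟨ha, hb, hR⟩ := h2
  obtain ⟨⟨-, hab', -⟩, ⟨hba', -, -⟩, hRR⟩ := h3
  refine ⟨?_, ?_, ?_⟩
  · rw [← h1]
    simp [BinTree.leaves, ← Multiset.coe_add, add_assoc]
  · simp only [Multiset.mem_cons, forall_eq_or_imp]
    exact ⟨⟨ha, hb, hab', hba'⟩, hR⟩
  · simp only [Multiset.mem_cons, forall_eq_or_imp]
    refine ⟨⟨BinTree.childMax_le_value v _, fun u hu => ?_⟩, fun t ht => ⟨?_, (hRR t ht).2.2⟩⟩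
    · exact max_le (hab.trans (hbS u hu)) (hbS u hu)
    · exact (hRR t ht).1.trans (Nat.le_add_right _ _)

theorem IsHuffmanTree.heap {α : Type*} [Fintype α] {v : α → ℕ} {t : BinTree α}
    (ht : IsHuffmanTree v t) : HuffmanHeap v {t} := by
  unfold IsHuffmanTree at ht
  generalize ({t} : Multiset (BinTree α)) = S at ht
  induction ht with
  | refl =>
    refine ⟨?_, ?_, ?_⟩
    · rw [Multiset.bind_map]
      simpa [BinTree.leaves] using Multiset.bind_singleton (Finset.univ : Finset α).val id
    · simp [BinTree.UncleDominates]
    · simp [BinTree.childMax]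
  | tail _ h ih => exact ih.step h

theorem IsHuffmanTree.isCodeTree {α : Type*} [Fintype α] {v : α → ℕ} {t : BinTree α}
    (ht : IsHuffmanTree v t) : t.IsCodeTree := by
  have h := ht.heap.leaves
  rw [Multiset.singleton_bind] at h
  refine ⟨Multiset.coe_nodup.1 (h ▸ Finset.univ.nodup), fun y => ?_⟩
  rw [← Multiset.mem_coe, h]
  exact Finset.mem_univ y

theorem IsHuffmanTree.mul_two_pow_le {α : Type*} [Fintype α] [DecidableEq α] {v : α → ℕ}
    {t : BinTree α} (ht : IsHuffmanTree v t) (y : α) :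
    v y * 2 ^ ((t.code y).length / 2) ≤ ∑ x, v x := by
  rw [← ht.isCodeTree.value_eq v]
  exact ((ht.heap.uncle t (by simp)).mul_two_pow_le_aux (ht.isCodeTree.2 y)).1

theorem List.sum_count_univ {α : Type*} [Fintype α] [DecidableEq α] (h : List α) :
    ∑ y, h.count y = h.length := by
  simpa using Multiset.sum_count_eq_card (s := Finset.univ) (m := (h : Multiset α)) (by simp)

/-- A Huffman tree for the counts of `h` has codes of length at most
`2 log₂ (1 / q y) + 1`, with `q` the empirical distribution of `h`. -/
theorem IsHuffmanTree.code_length_le {α : Type*} [Fintype α] [DecidableEq α] {h : List α}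
    {t : BinTree α} (ht : IsHuffmanTree (fun y => h.count y) t) {y : α} (hy : 0 < h.count y) :
    ((t.code y).length : ℝ)
      ≤ 2 * (Real.logb 2 h.length - Real.logb 2 (h.count y)) + 1 := by
  have h1 := ht.mul_two_pow_le y
  rw [List.sum_count_univ] at h1
  set d := (t.code y).length
  have h2 : ((h.count y : ℝ)) * 2 ^ (d / 2) ≤ h.length := by exact_mod_cast h1
  have hy' : (0 : ℝ) < h.count y := by exact_mod_cast hy
  have h3 := Real.logb_le_logb_of_le one_lt_two (by positivity) h2
  rw [Real.logb_mul hy'.ne' (by positivity), Real.logb_pow, Real.logb_self_eq_one one_lt_two]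
    at h3
  -- Rounding in `d / 2` loses at most one query: the summand `1` of the bound.
  have h4 : (d : ℝ) ≤ 2 * (d / 2 : ℕ) + 1 := by exact_mod_cast (by omega : d ≤ 2 * (d / 2) + 1)
  linarith

/-! ### Adaptive codes of sequences and Gibbs' inequality. -/

theorem totalQueries_cons {α : Type*} [DecidableEq α] (τ : List α → BinTree α) {n : ℕ}
    (y : α) (x : Fin n → α) :
    totalQueries τ (Fin.cons y x : Fin (n + 1) → α)
      = ((τ []).code y).length + totalQueries (fun h => τ (y :: h)) x := by
  simp [totalQueries, Fin.sum_univ_succ]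

/-- Kraft's equality for adaptive codes of sequences. -/
theorem sum_half_pow_totalQueries {α : Type*} [Fintype α] [DecidableEq α] (n : ℕ)
    (τ : List α → BinTree α) (hτ : ∀ h, (τ h).IsCodeTree) :
    ∑ x : Fin n → α, (1 / 2 : ℝ) ^ totalQueries τ x = 1 := by
  induction n generalizing τ with
  | zero => simp [totalQueries]
  | succ n ih =>
    -- Split off the first symbol: for each value of it, the weights of the remaining words sum to
    -- `1` by induction.
    rw [← (Fin.consEquiv fun _ : Fin (n + 1) => α).sum_comp, Fintype.sum_prod_type]
    refine Eq.trans ?_ (hτ []).kraft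
    refine Finset.sum_congr rfl fun y _ => ?_
    simp only [Fin.consEquiv, Equiv.coe_fn_mk, totalQueries_cons, pow_add]
    rw [← Finset.mul_sum, ih _ fun h => hτ _, mul_one]

/-- Gibbs' inequality against the (sub)probability weights `2 ^ (-L x)`. -/
theorem entropy₂_le_sum_mul {ι : Type*} [Fintype ι] (w : ι → ℝ) (hw : ∀ i, 0 ≤ w i)
    (hw1 : ∑ i, w i = 1) (L : ι → ℕ) (hL : ∑ i, (1 / 2 : ℝ) ^ L i ≤ 1) :
    entropy₂ w ≤ ∑ i, w i * L i := by
  have hlog : 0 < Real.log 2 := Real.log_pos one_lt_two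
  have key : ∀ i, -(w i * Real.log (w i)) - w i * (L i * Real.log 2)
      ≤ (1 / 2 : ℝ) ^ L i - w i := by
    intro i
    rcases (hw i).eq_or_lt with h | h
    · rw [← h]
      simp
    · have h1 := Real.log_le_sub_one_of_pos (x := (1 / 2 : ℝ) ^ L i / w i) (by positivity)
      rw [Real.log_div (by positivity) h.ne', Real.log_pow, one_div, Real.log_inv] at h1
      have h2 := mul_le_mul_of_nonneg_left h1 h.le
      rw [mul_sub, mul_sub, mul_div_cancel₀ _ h.ne'] at h2
      rw [one_div]
      linarith
  have hs := Finset.sum_le_sum fun i (_ : i ∈ Finset.univ) => key i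
  simp only [Finset.sum_sub_distrib, Finset.sum_neg_distrib] at hs
  have e1 : entropy₂ w * Real.log 2 = -∑ i, w i * Real.log (w i) := by
    rw [entropy₂, neg_mul, Finset.sum_mul]
    congr 1
    refine Finset.sum_congr rfl fun i _ => ?_
    rw [Real.logb]
    field_simp
  have e2 : (∑ i, w i * L i) * Real.log 2 = ∑ i, w i * (L i * Real.log 2) := by
    rw [Finset.sum_mul]
    exact Finset.sum_congr rfl fun i _ => by ring
  refine le_of_mul_le_mul_right ?_ hlog
  rw [e1, e2]
  linarith

/-! ### The telescoping sum of ideal code lengths. -/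

/-- `log₂ (n - 1)! - ∑ log₂ (N y - 1)!` for a list of length `n` with counts `N`. -/
noncomputable def logFactorialGap {α : Type*} [Fintype α] [DecidableEq α] (h : List α) : ℝ :=
  Real.logb 2 (h.length - 1).factorial - ∑ y, Real.logb 2 (h.count y - 1).factorial

theorem logb_factorial_eq (k : ℕ) :
    Real.logb 2 k.factorial = Real.logb 2 (k - 1).factorial + Real.logb 2 k := by
  rcases k with _ | k
  · simp
  · rw [Nat.factorial_succ, Nat.cast_mul, Real.logb_mul (by positivity) (by positivity), add_comm]
    rfl

/-- With `0 - 1 = 0` and `logb 2 0 = 0`, this also holds for the empty list and for a new symbol. -/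
theorem logFactorialGap_concat {α : Type*} [Fintype α] [DecidableEq α] (h : List α) (y : α) :
    logFactorialGap (h ++ [y])
      = logFactorialGap h + (Real.logb 2 h.length - Real.logb 2 (h.count y)) := by
  have e : ∀ z, Real.logb 2 ((h ++ [y]).count z - 1).factorial
      = Real.logb 2 (h.count z - 1).factorial + if z = y then Real.logb 2 (h.count y) else 0 := by
    intro z
    by_cases hz : z = y
    · subst hz
      simp only [List.count_append, List.count_singleton_self, Nat.add_sub_cancel, if_true]
      exact logb_factorial_eq _
    · simp [List.count_append, hz, Ne.symm hz]
  simp only [logFactorialGap, e, Finset.sum_add_distrib, Finset.sum_ite_eq', Finset.mem_univ,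
    if_true, List.length_append, List.length_singleton, Nat.add_sub_cancel]
  rw [logb_factorial_eq]
  ring

theorem logb_two_natCast_nonneg (k : ℕ) : 0 ≤ Real.logb 2 (k : ℝ) :=
  div_nonneg (Real.log_natCast_nonneg k) (Real.log_nonneg one_le_two)

/-- The multinomial coefficient of the counts of `h` is at most the inverse of the probability
of `h`. -/
theorem logFactorialGap_le {α : Type*} [Fintype α] [DecidableEq α] (p : α → ℝ)
    (hp : p ∈ stdSimplex ℝ α) (h : List α) (hh : ∀ y ∈ h, 0 < p y) :
    logFactorialGap h
      ≤ -(h.map fun y => Real.logb 2 (p y)).sum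
        + Fintype.card α * Real.logb 2 h.length := by
  have hpos : 0 < ∏ y, p y ^ h.count y := by
    refine Finset.prod_pos fun y _ => ?_
    by_cases hy : y ∈ h
    · exact pow_pos (hh y hy) _
    · simp [List.count_eq_zero_of_not_mem hy]
  -- The left side is one term of the multinomial expansion of `(∑ y, p y) ^ h.length = 1`.
  have hmul : (Nat.multinomial Finset.univ (fun y => h.count y) : ℝ) * ∏ y, p y ^ h.count y ≤ 1 := by
    have h1 := Finset.sum_pow_eq_sum_piAntidiag Finset.univ p h.length
    rw [hp.2, one_pow] at h1
    rw [h1]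
    refine Finset.single_le_sum (f := fun k : α → ℕ =>
      (Nat.multinomial Finset.univ k : ℝ) * ∏ i, p i ^ k i) (fun k _ => ?_) ?_
    · exact mul_nonneg (Nat.cast_nonneg _) (Finset.prod_nonneg fun i _ => pow_nonneg (hp.1 i) _)
    · simp [Finset.mem_piAntidiag, List.sum_count_univ]
  have hspec : ((∏ y, ((h.count y).factorial : ℝ)) * Nat.multinomial Finset.univ fun y => h.count y)
      = h.length.factorial := by
    have := Nat.multinomial_spec Finset.univ fun y => h.count y
    rw [List.sum_count_univ] at this
    exact_mod_cast this
  have hle : (h.length.factorial : ℝ) * ∏ y, p y ^ h.count y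
      ≤ ∏ y, ((h.count y).factorial : ℝ) := by
    rw [← hspec, mul_assoc]
    exact mul_le_of_le_one_right (Finset.prod_nonneg fun _ _ => Nat.cast_nonneg _) hmul
  have hlog := Real.logb_le_logb_of_le one_lt_two (by positivity) hle
  rw [Real.logb_mul (by positivity) hpos.ne',
    Real.logb_prod _ _ fun y hy => Finset.prod_ne_zero_iff.1 hpos.ne' y hy,
    Real.logb_prod _ _ fun y _ => by positivity] at hlog
  have hsum : (h.map fun y => Real.logb 2 (p y)).sum = ∑ y, Real.logb 2 (p y ^ h.count y) := by
    rw [Finset.sum_list_map_count, Finset.sum_subset (Finset.subset_univ _)]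
    · exact Finset.sum_congr rfl fun y _ => by rw [Real.logb_pow, nsmul_eq_mul]
    · intro y _ hy
      rw [List.count_eq_zero_of_not_mem (by simpa using hy), zero_smul]
  have hcount : ∑ y, Real.logb 2 (h.count y) ≤ Fintype.card α * Real.logb 2 h.length := by
    rw [← Finset.card_univ, ← nsmul_eq_mul]
    refine Finset.sum_le_card_nsmul _ _ _ fun y _ => ?_
    rcases (h.count y).eq_zero_or_pos with hy | hy
    · rw [hy, Nat.cast_zero, Real.logb_zero]
      exact logb_two_natCast_nonneg _
    · exact Real.logb_le_logb_of_le one_lt_two (by exact_mod_cast hy)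
        (by exact_mod_cast List.count_le_length)
  have hlen := logb_two_natCast_nonneg h.length
  have h1 := logb_factorial_eq h.length
  have h2 : ∑ y, Real.logb 2 (h.count y).factorial
      = ∑ y, Real.logb 2 (h.count y - 1).factorial + ∑ y, Real.logb 2 (h.count y) := by
    rw [← Finset.sum_add_distrib]
    exact Finset.sum_congr rfl fun y _ => logb_factorial_eq _
  rw [logFactorialGap, hsum]
  linarith

theorem totalQueries_succ {α : Type*} [DecidableEq α] (τ : List α → BinTree α) {n : ℕ}
    (x : Fin (n + 1) → α) :
    totalQueries τ x = totalQueries τ (fun i : Fin n => x i.castSucc)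
      + ((τ (List.ofFn fun i : Fin n => x i.castSucc)).code (x (Fin.last n))).length := by
  rw [totalQueries, Fin.sum_univ_castSucc, List.ofFn_succ']
  simp only [List.concat_eq_append, totalQueries, Fin.val_castSucc, Fin.val_last]
  congr 1
  · refine Finset.sum_congr rfl fun j _ => ?_
    rw [List.take_append_of_le_length (by simp)]
  · rw [List.take_left' (by simp)]

/-- Repeated symbols are paid for by the growth of `logFactorialGap`, new ones by the growth of the
set of symbols seen. -/
theorem totalQueries_le {α : Type*} [Fintype α] [DecidableEq α] {τ : List α → BinTree α}
    (hτ : ∀ h, (τ h).IsCodeTree) {a b : ℝ} (ha : 0 ≤ a) (hb : 0 ≤ b)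
    (hlen : ∀ (h : List α) (y : α), 0 < h.count y →
      (((τ h).code y).length : ℝ) ≤ a * (Real.logb 2 h.length - Real.logb 2 (h.count y)) + b)
    {n : ℕ} (x : Fin n → α) :
    (totalQueries τ x : ℝ) ≤ a * logFactorialGap (List.ofFn x) + b * n
      + Fintype.card α * (List.ofFn x).toFinset.card := by
  induction n with
  | zero => simp [totalQueries, logFactorialGap]
  | succ n ih =>
    have h1 := ih fun i : Fin n => x i.castSucc
    rw [totalQueries_succ, List.ofFn_succ', List.concat_eq_append, logFactorialGap_concat]
    set h := List.ofFn fun i : Fin n => x i.castSucc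
    set y := x (Fin.last n)
    have hcard : (h ++ [y]).toFinset.card = h.toFinset.card + if y ∈ h then 0 else 1 := by
      rw [List.toFinset_append, List.toFinset_cons, List.toFinset_nil, Finset.union_comm]
      split_ifs with hy <;> simp [hy]
    rw [hcard]
    push_cast
    rw [mul_add, mul_add, mul_add]
    split_ifs with hy
    · have h2 := hlen h y (List.count_pos_iff.2 hy)
      linarith
    · have h2 : (((τ h).code y).length : ℝ) ≤ Fintype.card α := by
        exact_mod_cast ((hτ h).code_length_lt_card y).le
      have h3 : 0 ≤ a * (Real.logb 2 h.length - Real.logb 2 (h.count y)) := by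
        rw [List.count_eq_zero_of_not_mem hy, Nat.cast_zero, Real.logb_zero, sub_zero]
        exact mul_nonneg ha (logb_two_natCast_nonneg _)
      linarith

/-! ### Expectations over i.i.d. samples. -/

theorem integral_comp_eq_sum {β Ω : Type*} [Fintype β] [MeasurableSpace β]
    [MeasurableSingletonClass β] [MeasurableSpace Ω] (μ : Measure Ω) [IsFiniteMeasure μ]
    {Z : Ω → β} (hZ : Measurable Z) (F : β → ℝ) :
    ∫ ω, F (Z ω) ∂μ = ∑ x, μ.real (Z ⁻¹' {x}) * F x := by
  rw [← integral_map hZ.aemeasurable (Measurable.of_discrete (f := F)).aestronglyMeasurable,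
    integral_fintype .of_finite]
  refine Finset.sum_congr rfl fun x _ => ?_
  rw [map_measureReal_apply hZ (measurableSet_singleton x), smul_eq_mul]

namespace IsIIDSample

variable {α Ω : Type*} [MeasurableSpace α] [MeasurableSpace Ω] {μ : Measure Ω} {n : ℕ}
  {Y : Fin n → Ω → α} {p : α → ℝ}

theorem measurable_pi (hY : IsIIDSample μ Y p) : Measurable fun ω j => Y j ω :=
  measurable_pi_lambda _ hY.measurable

theorem real_preimage_singleton [MeasurableSingletonClass α] (hY : IsIIDSample μ Y p)
    (x : Fin n → α) :
    μ.real ((fun ω j => Y j ω) ⁻¹' {x}) = ∏ j, p (x j) := by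
  have h1 := hY.indep.measure_inter_preimage_eq_mul Finset.univ (sets := fun j => {x j})
    fun j _ => measurableSet_singleton _
  have h2 : (fun ω j => Y j ω) ⁻¹' {x} = ⋂ j ∈ (Finset.univ : Finset (Fin n)), Y j ⁻¹' {x j} := by
    ext ω
    simp [funext_iff]
  rw [h2, Measure.real, h1, ENNReal.toReal_prod]
  exact Finset.prod_congr rfl fun j _ => hY.law j (x j)

variable [Fintype α] [MeasurableSingletonClass α] [IsProbabilityMeasure μ]

theorem integral_eq_sum (hY : IsIIDSample μ Y p) (F : (Fin n → α) → ℝ) :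
    ∫ ω, F (fun j => Y j ω) ∂μ = ∑ x, (∏ j, p (x j)) * F x := by
  rw [integral_comp_eq_sum μ hY.measurable_pi F]
  exact Finset.sum_congr rfl fun x _ => by rw [hY.real_preimage_singleton]

theorem sum_prod (hY : IsIIDSample μ Y p) : ∑ x : Fin n → α, ∏ j, p (x j) = 1 := by
  simpa using (hY.integral_eq_sum fun _ => 1).symm

theorem sum_prod_mul_logb (hY : IsIIDSample μ Y p) :
    ∑ x : Fin n → α, (∏ j, p (x j)) * ∑ j, Real.logb 2 (p (x j)) = -(n * entropy₂ p) := by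
  have hint : ∀ j, Integrable (fun ω => Real.logb 2 (p (Y j ω))) μ := fun j =>
    (Integrable.of_finite (f := fun y => Real.logb 2 (p y))).comp_measurable (hY.measurable j)
  rw [← hY.integral_eq_sum fun x => ∑ j, Real.logb 2 (p (x j)),
    integral_finsetSum _ fun j _ => hint j]
  have h1 : ∀ j, ∫ ω, Real.logb 2 (p (Y j ω)) ∂μ = -entropy₂ p := by
    intro j
    rw [integral_comp_eq_sum μ (hY.measurable j) fun y => Real.logb 2 (p y), entropy₂, neg_neg]
    exact Finset.sum_congr rfl fun y _ => by rw [hY.law]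
  simp [h1]

theorem entropy₂_prod (hY : IsIIDSample μ Y p) :
    entropy₂ (fun x : Fin n → α => ∏ j, p (x j)) = n * entropy₂ p := by
  rw [← neg_neg (n * entropy₂ p : ℝ), ← hY.sum_prod_mul_logb, entropy₂]
  congr 1
  refine Finset.sum_congr rfl fun x _ => ?_
  by_cases hx : ∏ j, p (x j) = 0
  · rw [hx, zero_mul, zero_mul]
  · rw [Real.logb_prod _ _ fun j hj => Finset.prod_ne_zero_iff.1 hx j hj]

theorem mul_entropy₂_le_integral [DecidableEq α] (hY : IsIIDSample μ Y p)
    (hp : p ∈ stdSimplex ℝ α) {τ : List α → BinTree α} (hτ : ∀ h, (τ h).IsCodeTree) :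
    n * entropy₂ p ≤ ∫ ω, (totalQueries τ (fun j => Y j ω) : ℝ) ∂μ := by
  rw [hY.integral_eq_sum fun x => (totalQueries τ x : ℝ), ← hY.entropy₂_prod]
  exact entropy₂_le_sum_mul _ (fun x => Finset.prod_nonneg fun j _ => hp.1 _) hY.sum_prod _
    (sum_half_pow_totalQueries n τ hτ).le

theorem integral_totalQueries_le [DecidableEq α] (hY : IsIIDSample μ Y p)
    (hp : p ∈ stdSimplex ℝ α) {τ : List α → BinTree α} (hτ : ∀ h, (τ h).IsCodeTree)
    {a b : ℝ} (ha : 0 ≤ a) (hb : 0 ≤ b)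
    (hlen : ∀ (h : List α) (y : α), 0 < h.count y →
      (((τ h).code y).length : ℝ) ≤ a * (Real.logb 2 h.length - Real.logb 2 (h.count y)) + b) :
    ∫ ω, (totalQueries τ (fun j => Y j ω) : ℝ) ∂μ
      ≤ a * (n * entropy₂ p) + b * n
        + (a * Fintype.card α * Real.logb 2 n + (Fintype.card α : ℝ) ^ 2) := by
  rw [hY.integral_eq_sum fun x => (totalQueries τ x : ℝ)]
  set K : ℝ := b * n + (a * Fintype.card α * Real.logb 2 n + (Fintype.card α : ℝ) ^ 2) with hK
  have key : ∀ x : Fin n → α, (∏ j, p (x j)) * (totalQueries τ x : ℝ)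
      ≤ (-a) * ((∏ j, p (x j)) * ∑ j, Real.logb 2 (p (x j))) + (∏ j, p (x j)) * K := by
    intro x
    -- Sequences of probability zero contribute nothing; on the others every logarithm is genuine.
    by_cases hx : ∏ j, p (x j) = 0
    · simp [hx]
    · have hpos : ∀ y ∈ List.ofFn x, 0 < p y := by
        intro y hy
        obtain ⟨j, rfl⟩ := List.mem_ofFn.1 hy
        exact (hp.1 _).lt_of_ne' (Finset.prod_ne_zero_iff.1 hx j (Finset.mem_univ j))
      have h1 := mul_le_mul_of_nonneg_left (logFactorialGap_le p hp _ hpos) ha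
      rw [List.map_ofFn, List.sum_ofFn, List.length_ofFn] at h1
      have h2 := totalQueries_le hτ ha hb hlen x
      have h3 : (Fintype.card α : ℝ) * (List.ofFn x).toFinset.card ≤ (Fintype.card α : ℝ) ^ 2 := by
        rw [sq]
        exact mul_le_mul_of_nonneg_left (by exact_mod_cast Finset.card_le_univ _)
          (Nat.cast_nonneg _)
      have h4 : (totalQueries τ x : ℝ) ≤ (-a) * ∑ j, Real.logb 2 (p (x j)) + K := by
        simp only [Function.comp_def] at h1
        rw [hK]
        linarith
      have h5 := mul_le_mul_of_nonneg_left h4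
        (Finset.prod_nonneg fun j (_ : j ∈ Finset.univ) => hp.1 (x j))
      linarith
  refine (Finset.sum_le_sum fun x _ => key x).trans (le_of_eq ?_)
  rw [Finset.sum_add_distrib, ← Finset.mul_sum, ← Finset.sum_mul, hY.sum_prod,
    hY.sum_prod_mul_logb, hK]
  ring

end IsIIDSample

/-! ### Balanced schemes and the conclusion. -/

theorem CodingScheme.IsBalanced.nonneg {α : Type*} [Fintype α] [DecidableEq α] [Nonempty α]
    {A : CodingScheme α} {C : ℝ} (hA : A.IsBalanced C) : 0 ≤ C := by
  obtain ⟨y⟩ := ‹Nonempty α›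
  -- At a point mass the factor of `C` is `1`, so `C` bounds a code length.
  have h := hA (Pi.single y 1) (single_mem_stdSimplex ℝ y) y (by simp)
  simp only [Pi.single_eq_same, div_one, Real.logb_one, Int.floor_zero, Int.cast_zero, zero_add,
    mul_one] at h
  exact (Nat.cast_nonneg _).trans h

theorem empirical_mem_stdSimplex {α : Type*} [Fintype α] [DecidableEq α] {h : List α}
    (hh : h ≠ []) : empirical h ∈ stdSimplex ℝ α := by
  refine ⟨fun y => div_nonneg (Nat.cast_nonneg _) (Nat.cast_nonneg _), ?_⟩
  have h0 : (h.length : ℝ) ≠ 0 := by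
    exact_mod_cast fun h0 => hh (List.length_eq_zero_iff.1 h0)
  simp only [empirical]
  rw [← Finset.sum_div, ← Nat.cast_sum, List.sum_count_univ, div_self h0]

theorem CodingScheme.IsBalanced.adaptiveTree_code_length_le {α : Type*} [Fintype α]
    [DecidableEq α] {A : CodingScheme α} {C : ℝ} (hA : A.IsBalanced C) (hC : 0 ≤ C)
    (T₀ : BinTree α) {h : List α} {y : α} (hy : 0 < h.count y) :
    (((adaptiveTree A T₀ h).code y).length : ℝ)
      ≤ C * (Real.logb 2 h.length - Real.logb 2 (h.count y)) + C := by
  rcases h with _ | ⟨z, h⟩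
  · simp at hy
  · have hc : (0 : ℝ) < (z :: h).count y := by exact_mod_cast hy
    have hl : (0 : ℝ) < (z :: h).length := by simp only [List.length_cons]; positivity
    have h1 := hA _ (empirical_mem_stdSimplex (List.cons_ne_nil z h)) y (div_pos hc hl)
    have h2 := Int.floor_le (Real.logb 2 (1 / empirical (z :: h) y))
    rw [adaptiveTree]
    refine h1.trans ?_
    rw [← mul_add_one]
    refine mul_le_mul_of_nonneg_left (add_le_add (h2.trans (le_of_eq ?_)) le_rfl) hC
    rw [empirical, one_div_div, Real.logb_div hl.ne' hc.ne']

theorem adaptiveTree_isCodeTree {α : Type*} [DecidableEq α] (A : CodingScheme α)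
    {T₀ : BinTree α} (h₀ : T₀.IsCodeTree) (h : List α) : (adaptiveTree A T₀ h).IsCodeTree := by
  cases h with
  | nil => exact h₀
  | cons y h => exact A.isCodeTree _

theorem isLittleO_logb_add_const (a b : ℝ) :
    (fun n : ℕ => a * Real.logb 2 n + b) =o[atTop] fun n : ℕ => (n : ℝ) := by
  have h1 : (fun n : ℕ => Real.log n) =o[atTop] fun n : ℕ => (n : ℝ) :=
    Real.isLittleO_log_id_atTop.comp_tendsto tendsto_natCast_atTop_atTop
  have h2 : (fun _ : ℕ => b) =o[atTop] fun n : ℕ => (n : ℝ) :=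
    (isLittleO_const_id_atTop b).comp_tendsto tendsto_natCast_atTop_atTop
  refine IsLittleO.add ?_ h2
  refine (h1.const_mul_left (a / Real.log 2)).congr_left fun n => ?_
  rw [Real.logb]
  ring

theorem mainTheorem4 {α : Type*} [Fintype α] [DecidableEq α] [MeasurableSpace α]
    [MeasurableSingletonClass α] :
    -- adaptive coding with a `C`-balanced coding scheme and any initial tree
    (∀ (C : ℝ) (A : CodingScheme α) (T₀ : BinTree α), A.IsBalanced C → T₀.IsCodeTree →
      ∀ (p : α → ℝ), p ∈ stdSimplex ℝ α →
      ∀ (n : ℕ), 1 ≤ n →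
      ∀ {Ω : Type*} [MeasurableSpace Ω] (μ : Measure Ω) [IsProbabilityMeasure μ]
        (Y : Fin n → Ω → α), IsIIDSample μ Y p →
        (n : ℝ) * entropy₂ p
            ≤ ∫ ω, (totalQueries (adaptiveTree A T₀) (fun j => Y j ω) : ℝ) ∂μ ∧
        ∫ ω, (totalQueries (adaptiveTree A T₀) (fun j => Y j ω) : ℝ) ∂μ
            ≤ C * n * (entropy₂ p + 1) + 28 * C * (Fintype.card α : ℝ) * Real.logb 2 n
              + 6 * C * (Fintype.card α : ℝ) + (Fintype.card α : ℝ) ^ 2) ∧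
    -- adaptive Huffman coding: the tree in use is a Huffman tree for the current counts,
    -- updated in any way; the remainder `R` does not depend on `p` or on the trees
    (∃ R : ℕ → ℝ, R =o[atTop] (fun n : ℕ => (n : ℝ)) ∧
      ∀ (τ : List α → BinTree α), (∀ h : List α, IsHuffmanTree (fun y => h.count y) (τ h)) →
      ∀ (p : α → ℝ), p ∈ stdSimplex ℝ α →
      ∀ (n : ℕ) {Ω : Type*} [MeasurableSpace Ω] (μ : Measure Ω) [IsProbabilityMeasure μ]
        (Y : Fin n → Ω → α), IsIIDSample μ Y p →
        (n : ℝ) * entropy₂ p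
            ≤ ∫ ω, (totalQueries τ (fun j => Y j ω) : ℝ) ∂μ ∧
        ∫ ω, (totalQueries τ (fun j => Y j ω) : ℝ) ∂μ
            ≤ 2 * n * (entropy₂ p + 1) + R n) := by
  constructor
  · intro C A T₀ hA hT p hp n hn Ω _ μ _ Y hY
    have : Nonempty α := by
      by_contra h
      rw [not_nonempty_iff] at h
      simpa using hp.2
    have hC := hA.nonneg
    have hτ := adaptiveTree_isCodeTree A hT
    refine ⟨hY.mul_entropy₂_le_integral hp hτ, ?_⟩
    have h1 := hY.integral_totalQueries_le hp hτ hC hC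
      fun h y hy => hA.adaptiveTree_code_length_le hC T₀ hy
    have h2 : 0 ≤ C * Fintype.card α := mul_nonneg hC (Nat.cast_nonneg _)
    have h3 := mul_nonneg h2 (logb_two_natCast_nonneg n)
    -- The argument gives `C m log₂ n + m²`; the constants `28` and `6` leave slack.
    linarith
  · refine ⟨fun n => 2 * Fintype.card α * Real.logb 2 n + (Fintype.card α : ℝ) ^ 2,
      isLittleO_logb_add_const _ _, ?_⟩
    intro τ hτ p hp n Ω _ μ _ Y hY
    have hc := fun h => (hτ h).isCodeTree
    refine ⟨hY.mul_entropy₂_le_integral hp hc, ?_⟩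
    have h1 := hY.integral_totalQueries_le hp hc zero_le_two zero_le_one
      fun h y hy => (hτ h).code_length_le hy
    have h2 : (0 : ℝ) ≤ n := Nat.cast_nonneg n
    linarith
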